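/- Let $N\ge 1$ be partitioned as $N=m_1+\dots+m_\phi+\sigma$. Let $K=\mathrm{diag}(k_1,\dots,k_N)$ with $k_i>0$, $\bar\varGamma=\mathrm{diag}(\bar\gamma_1,\dots,\bar\gamma_N)$ with $\bar\gamma_i\ge 0$, $H=\mathrm{diag}(h_1,\dots,h_N)$ with $h_i>0$. Let $G\in\mathbb R^{N\times N}$ be nonnegative with zero diagonal (entries $g_{ji}\ge 0$ for $j\ne i$), let $E,F\in\mathbb R^{N\times N}$ be nonnegative matrices, and let $\varepsilon_2>0$ and $\varsigma_2\in(0,1)$. Put $$\boldsymbol\Delta=\{\mathrm{blkdiag}(\Delta_1,\dots,\Delta_\phi,\delta_{\phi+1},\dots,\delta_{\phi+\sigma}):\ \Delta_k\in\mathbb R^{m_k\times m_k}_{\ge 0},\ \delta_k\in\mathbb R_{\ge 0}\},$$ $$\mathbb K=\{\mathrm{diag}(\pi_1I_{m_1},\dots,\pi_\phi I_{m_\phi},\pi_{\phi+1},\dots,\pi_{\phi+\sigma}):\ \pi_k>0\},$$ and consider the uncertain system $x(t+1)=\big(K(-I_N+\bar\varGamma H^{-1}G)+I_N\big)x(t)+K\bar\varGamma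 H^{-1}E\Delta F\,x(t)$ with $\Delta\in\boldsymbol\Delta$. Let $$\varGamma_2=\sup_{\Delta\in\boldsymbol\Delta,\ \|\Delta\|_2\le\varepsilon_2}\lambda_{\max}\big(K(-I_N+\bar\varGamma H^{-1}G)+K\bar\varGamma H^{-1}E\Delta F\big),$$ where $\lambda_{\max}$ is the maximum real eigenvalue and $\|\cdot\|_2$ is the largest singular value. For $\varsigma>0$ let (C2)$_{\varsigma}$ be the statement that there exist entrywise positive vectors $u,\nu,\xi,\zeta\in\mathbb R^N$ and a matrix $\varPi\in\mathbb K$ such that, entrywise, $$\sqrt{\varepsilon_2}\,\varPi^{1/2}F\xi<\nu,$$ $$(K(-I_N+\bar\varGamma H^{-1}G)+\varsigma I_N)\xi+\sqrt{\varepsilon_2}\,K\bar\varGamma H^{-1}E\varPi^{-1/2}u<0,$$ $$\sqrt{\varepsilon_2}\,\varPi^{-1/2}E^{\mathrm T}H^{-1}\bar\varGamma K\zeta<u,$$ $$((-I_N+G^{\mathrm T}H^{-1}\bar\varGamma)K+\varsigma I_N)\zeta+\sqrt{\varepsilon_2}\,F^{\mathrm T}\varPi^{1/2}\nu<0.$$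 Then $\varGamma_2<-\varsigma_2$ holds if and only if (C2)$_{\varsigma_2}$ holds. Moreover, the non-strict condition (T2), $\varGamma_2\le-\varsigma_2$, holds if and only if (C2)$_{\varsigma}$ holds for every $\varsigma\in(0,\varsigma_2)$. -/

import Mathlib

open Matrix

/-- The index set `{1, …, N}` of the channels, `N = m₁ + ⋯ + m_φ + σ`, split into the `φ` consecutive
blocks of sizes `m₁, …, m_φ` followed by `σ` single indices. -/
abbrev BlockIndex {φ : ℕ} (m : Fin φ → ℕ) (σ : ℕ) : Type :=
  (Σ k : Fin φ, Fin (m k)) ⊕ Fin σ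

/-- Square real matrices of order `N`. -/
abbrev BlockMatrix {φ : ℕ} (m : Fin φ → ℕ) (σ : ℕ) : Type :=
  Matrix (BlockIndex m σ) (BlockIndex m σ) ℝ

/-- `blkdiag(Δ₁, …, Δ_φ, δ_{φ+1}, …, δ_{φ+σ})`. -/
def blkdiag {φ σ : ℕ} {m : Fin φ → ℕ} (D : ∀ k : Fin φ, Matrix (Fin (m k)) (Fin (m k)) ℝ)
    (d : Fin σ → ℝ) : BlockMatrix m σ :=
  Matrix.fromBlocks (Matrix.blockDiagonal' D) 0 0 (Matrix.diagonal d)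

/-- The structured uncertainty set: nonnegative matrices `blkdiag(Δ₁, …, Δ_φ, δ_{φ+1}, …, δ_{φ+σ})`. -/
def uncertaintySet {φ : ℕ} (m : Fin φ → ℕ) (σ : ℕ) : Set (BlockMatrix m σ) :=
  {Δ | ∃ (D : ∀ k : Fin φ, Matrix (Fin (m k)) (Fin (m k)) ℝ) (d : Fin σ → ℝ),
    (∀ k i j, 0 ≤ D k i j) ∧ (∀ l, 0 ≤ d l) ∧ Δ = blkdiag D d}

/-- The scaling set `𝕂`: matrices `diag(π₁ I_{m₁}, …, π_φ I_{m_φ}, π_{φ+1}, …, π_{φ+σ})` with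
all `π_k` positive. -/
def scalingSet {φ : ℕ} (m : Fin φ → ℕ) (σ : ℕ) : Set (BlockMatrix m σ) :=
  {P | ∃ (p : Fin φ → ℝ) (q : Fin σ → ℝ),
    (∀ k, 0 < p k) ∧ (∀ l, 0 < q l) ∧
      P = blkdiag (fun k => p k • (1 : Matrix (Fin (m k)) (Fin (m k)) ℝ)) q}

/-- The power `P ^ s` of a diagonal matrix `P` with positive diagonal entries. -/
noncomputable def diagPow {ι : Type*} [DecidableEq ι] (P : Matrix ι ι ℝ) (s : ℝ) :
    Matrix ι ι ℝ :=
  Matrix.diagonal fun i => P i i ^ s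

/-- The matrix 2-norm (largest singular value), as the operator norm for the Euclidean norm. -/
noncomputable def twoNorm {ι : Type*} [Fintype ι] [DecidableEq ι] (A : Matrix ι ι ℝ) : ℝ :=
  ‖Matrix.toEuclideanCLM (n := ι) (𝕜 := ℝ) A‖

/-- The maximum real eigenvalue of a square real matrix. The set of real eigenvalues is finite, and
for a Metzler matrix of positive order it is nonempty. -/
noncomputable def lambdaMax {ι : Type*} [Fintype ι] [DecidableEq ι] (A : Matrix ι ι ℝ) : ℝ :=
  sSup (spectrum ℝ A)

/-- The interference matrix `G`: the off-diagonal entry `(j, i)` is `g j i`, the diagonal is zero. -/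
def interferenceMatrix {ι : Type*} [DecidableEq ι] (g : ι → ι → ℝ) : Matrix ι ι ℝ :=
  Matrix.of fun j i => if i = j then 0 else g j i

/-- The matrix `K (-I + Γ H⁻¹ G) + K Γ H⁻¹ E Δ F`, where `K = diag(k)`, `Γ = diag(γ)`,
`H = diag(h)`. The closed loop is `x(t+1) = (closedLoop + I) x(t)`. -/
noncomputable def closedLoop {ι : Type*} [Fintype ι] [DecidableEq ι] (k γ h : ι → ℝ)
    (G E F Δ : Matrix ι ι ℝ) : Matrix ι ι ℝ :=
  diagonal k * (-1 + diagonal γ * (diagonal h)⁻¹ * G)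
    + diagonal k * diagonal γ * (diagonal h)⁻¹ * E * Δ * F

/-- `sup { λ_max(K (-I + Γ H⁻¹ G) + K Γ H⁻¹ E Δ F) : Δ structured, ‖Δ‖₂ ≤ ε }`, as an extended
real number. -/
noncomputable def worstCaseRate {φ σ : ℕ} {m : Fin φ → ℕ} (k γ h : BlockIndex m σ → ℝ)
    (G E F : BlockMatrix m σ) (ε : ℝ) : EReal :=
  ⨆ Δ ∈ {Δ : BlockMatrix m σ | Δ ∈ uncertaintySet m σ ∧ twoNorm Δ ≤ ε},
    ((lambdaMax (closedLoop k γ h G E F Δ) : ℝ) : EReal)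

/-- Feasibility of the four vector inequalities (all of them entrywise and strict) in positive
vectors `u, ν, ξ, ζ` and a scaling matrix `P ∈ 𝕂`. -/
def ScaledFeasible {φ σ : ℕ} {m : Fin φ → ℕ} (k γ h : BlockIndex m σ → ℝ)
    (G E F : BlockMatrix m σ) (ε ς : ℝ) : Prop :=
  ∃ u ν ξ ζ : BlockIndex m σ → ℝ, ∃ P ∈ scalingSet m σ,
    (∀ i, 0 < u i) ∧ (∀ i, 0 < ν i) ∧ (∀ i, 0 < ξ i) ∧ (∀ i, 0 < ζ i) ∧
    (∀ i, (√ε • ((diagPow P (1 / 2) * F) *ᵥ ξ)) i < ν i) ∧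
    (∀ i, ((diagonal k * ((-1 : BlockMatrix m σ) + diagonal γ * (diagonal h)⁻¹ * G)
        + ς • (1 : BlockMatrix m σ)) *ᵥ ξ
      + √ε • ((diagonal k * diagonal γ * (diagonal h)⁻¹ * E * diagPow P (-(1 / 2))) *ᵥ u) :
        BlockIndex m σ → ℝ) i < 0) ∧
    (∀ i, (√ε • ((diagPow P (-(1 / 2)) * Eᵀ * (diagonal h)⁻¹ * diagonal γ * diagonal k) *ᵥ ζ)) i
        < u i) ∧
    (∀ i, ((((-1 : BlockMatrix m σ) + Gᵀ * (diagonal h)⁻¹ * diagonal γ) * diagonal k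
        + ς • (1 : BlockMatrix m σ)) *ᵥ ζ
      + √ε • ((Fᵀ * diagPow P (1 / 2)) *ᵥ ν) : BlockIndex m σ → ℝ) i < 0)

/-! Let `A = K(-I + ΓH⁻¹G) + ςI`, which is Metzler, and `B = KΓH⁻¹E ≥ 0`. The strict claim becomes:
`A + BΔF` has only negative real eigenvalues for every admissible `Δ` iff the four inequalities are
solvable. Under either condition `R = -A⁻¹` exists and is nonnegative, and everything is governed by
the nonnegative matrix `M = FRB`. The pivot is a block-constant weight `p` with `ε² ∑ pᵢ(Mq)ᵢ² < ∑
pᵢqᵢ²` for all nonnegative `q ≠ 0`.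

Sufficiency (`Certified.spectrum_neg`): eliminating `ξ` and `ζ` through `R` leaves `ε pMU < V` and
`ε MᵀV < pU`, so a Schur test gives the weighted contraction. An eigenvector `x` with eigenvalue `≥
0` would yield `z = ΔF|x| ≠ 0` with `z ≤ ΔMz`, although `Δ` expands the weighted norm by at most
`ε`.

Necessity (`certified_of_spectrum_neg`): in the variables `s = q²` the block energies of `Mq` are
concave because `M ≥ 0`, so separation loses nothing. Either some `q` satisfies `‖q_k‖ ≤ ε‖(Mq)_k‖`
in every block, and rank-one blocks give an admissible `Δ` with `ΔMq = q`, making `0` an eigenvalue;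
or the weight `p` exists. Ville's theorem then supplies `U`, and small slacks supply `V`, `ξ`, `ζ`.

Certificates survive a small shift of `A`, which keeps the supremum strictly below `-ς`. The
non-strict claim follows by letting the level vary. -/

/-- Strict inequalities between two finite families survive a small positive perturbation. -/
theorem eventually_add_mul_lt {ι : Type*} [Finite ι] {a c : ι → ℝ} (b : ι → ℝ)
    (hac : ∀ i, a i < c i) :
    ∀ᶠ δ in nhdsWithin (0 : ℝ) (Set.Ioi 0), ∀ i, a i + δ * b i < c i := by
  rw [Filter.eventually_all]
  intro i
  have hc : Continuous fun δ : ℝ => a i + δ * b i := by fun_prop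
  have h0 : (fun δ : ℝ => a i + δ * b i) 0 < c i := by simpa using hac i
  exact (hc.continuousAt.eventually_lt continuousAt_const h0).filter_mono nhdsWithin_le_nhds

/-! ### Theorems of the alternative -/

open scoped Pointwise in
/-- A theorem of the alternative for concave maps on the simplex: some point is mapped to a
nonnegative vector, or some positive functional is negative on the whole image. -/
theorem exists_nonneg_or_exists_pos_weights {ι κ : Type*} [Fintype ι] [Fintype κ]
    [DecidableEq κ] (f : (ι → ℝ) → κ → ℝ) (hf : Continuous f)
    (hconc : ∀ k, ConcaveOn ℝ (stdSimplex ℝ ι) fun s => f s k) :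
    (∃ s ∈ stdSimplex ℝ ι, ∀ k, 0 ≤ f s k) ∨
      ∃ p : κ → ℝ, (∀ k, 0 < p k) ∧ ∀ s ∈ stdSimplex ℝ ι, ∑ k, p k * f s k < 0 := by
  rcases (stdSimplex ℝ ι).eq_empty_or_nonempty with hS | ⟨s₀, hs₀⟩
  · exact Or.inr ⟨fun _ => 1, fun _ => one_pos, fun s hs => by simp [hS] at hs⟩
  rw [or_iff_not_imp_left]
  intro hno
  push Not at hno
  -- Passing to the downward closure of the image makes the set convex, by concavity of `f`, and
  -- forces the separating functional to be nonnegative.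
  set D : Set (κ → ℝ) := {v | ∃ s ∈ stdSimplex ℝ ι, v ≤ f s} with hD
  have hDconv : Convex ℝ D := by
    rintro v ⟨s, hs, hv⟩ w ⟨t, ht, hw⟩ a b ha hb hab
    refine ⟨a • s + b • t, convex_stdSimplex ℝ ι hs ht ha hb hab, fun k => ?_⟩
    refine le_trans ?_ ((hconc k).2 hs ht ha hb hab)
    simp only [Pi.add_apply, Pi.smul_apply, smul_eq_mul]
    exact add_le_add (mul_le_mul_of_nonneg_left (hv k) ha)
      (mul_le_mul_of_nonneg_left (hw k) hb)
  have hDeq : D = Set.Iic (0 : κ → ℝ) + f '' stdSimplex ℝ ι := by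
    ext v
    simp only [hD, Set.mem_ofPred_eq, Set.mem_add, Set.mem_Iic, Set.mem_image]
    constructor
    · rintro ⟨s, hs, hv⟩
      exact ⟨v - f s, sub_nonpos.2 hv, _, ⟨s, hs, rfl⟩, sub_add_cancel _ _⟩
    · rintro ⟨w, hw, _, ⟨s, hs, rfl⟩, rfl⟩
      exact ⟨s, hs, add_le_of_nonpos_left hw⟩
  have hDcl : IsClosed D := by
    rw [hDeq]
    exact isClosed_Iic.add_right_of_isCompact ((isCompact_stdSimplex ℝ ι).image hf)
  have h0 : (0 : κ → ℝ) ∉ D := by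
    rintro ⟨s, hs, h⟩
    obtain ⟨k, hk⟩ := hno s hs
    exact absurd (h k) (not_le.2 hk)
  obtain ⟨l, u, hlu, hu0⟩ := geometric_hahn_banach_closed_point hDconv hDcl h0
  rw [map_zero] at hu0
  set p : κ → ℝ := fun k => l (Pi.single k 1) with hp
  have hl : ∀ v : κ → ℝ, l v = ∑ k, p k * v k := by
    intro v
    conv_lhs => rw [pi_eq_sum_univ' v]
    simp [map_sum, hp, mul_comm]
  have hp0 : ∀ k, 0 ≤ p k := by
    intro k
    by_contra! hk
    have hfs : l (f s₀) < u := hlu _ ⟨s₀, hs₀, le_rfl⟩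
    -- Moving down along coordinate `k` stays in `D` but raises `l`; this `t` is where `l` reaches
    -- the bound `u`.
    set t : ℝ := (u - l (f s₀)) / (-p k) with ht
    have ht0 : 0 ≤ t := div_nonneg (by linarith) (by linarith)
    have hmem : f s₀ - t • Pi.single k (1 : ℝ) ∈ D := by
      refine ⟨s₀, hs₀, sub_le_self _ (smul_nonneg ht0 ?_)⟩
      exact Pi.single_nonneg.2 zero_le_one
    have := hlu _ hmem
    rw [map_sub, map_smul, smul_eq_mul] at this
    have htp : t * p k = -(u - l (f s₀)) := by
      rw [ht]; field_simp [hk.ne]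
    change l (f s₀) - t * p k < u at this
    rw [htp] at this
    linarith
  have hcont : ContinuousOn (fun s => ∑ k, f s k) (stdSimplex ℝ ι) := by fun_prop
  obtain ⟨C, hC⟩ := (isCompact_stdSimplex ℝ ι).bddAbove_image hcont
  have hC' : ∀ s ∈ stdSimplex ℝ ι, ∑ k, f s k ≤ max C 1 := fun s hs =>
    (hC (Set.mem_image_of_mem _ hs)).trans (le_max_left _ _)
  have hC1 : 0 < max C 1 := lt_max_of_lt_right one_pos
  -- The weights `p` may vanish. Since `u < 0`, there is room to add a positive constant, sized by
  -- the bound on `∑ k, f s k` over the compact simplex.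
  refine ⟨fun k => p k + (-u) / max C 1, fun k => add_pos_of_nonneg_of_pos (hp0 k)
    (div_pos (by linarith) hC1), fun s hs => ?_⟩
  have h1 : ∑ k, p k * f s k < u := by
    rw [← hl]
    exact hlu _ ⟨s, hs, le_rfl⟩
  have h2 : (-u) / max C 1 * ∑ k, f s k ≤ -u := by
    calc (-u) / max C 1 * ∑ k, f s k ≤ (-u) / max C 1 * max C 1 :=
          mul_le_mul_of_nonneg_left (hC' s hs) (div_nonneg (by linarith) hC1.le)
      _ = -u := by field_simp
  simp only [add_mul, Finset.sum_add_distrib, ← Finset.mul_sum]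
  linarith

/-- Ville's theorem of the alternative. -/
theorem exists_nonneg_transpose_or_exists_pos_neg {ι : Type*} [Fintype ι] [DecidableEq ι]
    (Q : Matrix ι ι ℝ) :
    (∃ y : ι → ℝ, (∀ i, 0 ≤ y i) ∧ y ≠ 0 ∧ ∀ i, 0 ≤ (Qᵀ *ᵥ y) i) ∨
      ∃ x : ι → ℝ, (∀ i, 0 < x i) ∧ ∀ i, (Q *ᵥ x) i < 0 := by
  have hcont : Continuous fun y : ι → ℝ => Qᵀ *ᵥ y := by fun_prop
  rcases exists_nonneg_or_exists_pos_weights (fun y : ι → ℝ => Qᵀ *ᵥ y) hcont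
    (fun k => ⟨convex_stdSimplex ℝ ι, fun x _ y _ a b _ _ _ => by
      simp [mulVec_add, mulVec_smul]⟩) with ⟨y, hy, h⟩ | ⟨p, hp, h⟩
  · refine Or.inl ⟨y, hy.1, ?_, h⟩
    rintro rfl
    simpa using hy.2
  · refine Or.inr ⟨p, hp, fun i => ?_⟩
    have := h _ (single_mem_stdSimplex ℝ i)
    simpa [mulVec, dotProduct, transpose_apply, Pi.single_apply, mul_comm] using this

/-! ### Metzler matrices and their real spectrum -/

/-- A Metzler matrix: all off-diagonal entries are nonnegative. -/
def IsMetzler {ι : Type*} (A : Matrix ι ι ℝ) : Prop :=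
  ∀ i j, i ≠ j → 0 ≤ A i j

namespace IsMetzler

variable {ι : Type*} [Fintype ι] [DecidableEq ι] {A : Matrix ι ι ℝ}

theorem transpose {ι : Type*} {A : Matrix ι ι ℝ} (hA : IsMetzler A) : IsMetzler Aᵀ :=
  fun i j hij => hA j i hij.symm

theorem add_smul_one {ι : Type*} [DecidableEq ι] {A : Matrix ι ι ℝ} (hA : IsMetzler A)
    (t : ℝ) : IsMetzler (A + t • (1 : Matrix ι ι ℝ)) := by
  intro i j hij
  simpa [one_apply_ne hij] using hA i j hij

/-- A Metzler matrix that maps some positive vector to a negative vector is inverse-monotone: `A x ≤ 0` forces `0 ≤ x`. -/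
theorem nonneg_of_mulVec_nonpos {ι : Type*} [Fintype ι] {A : Matrix ι ι ℝ}
    (hA : IsMetzler A) {ξ : ι → ℝ} (hξ : ∀ i, 0 < ξ i)
    (hAξ : ∀ i, (A *ᵥ ξ) i < 0) {x : ι → ℝ} (hx : ∀ i, (A *ᵥ x) i ≤ 0) : ∀ i, 0 ≤ x i := by
  by_contra! hneg
  obtain ⟨j, hj⟩ := hneg
  -- At the minimal ratio `c < 0`, the vector `x - cξ` is nonnegative and vanishes at `i`, so row
  -- `i` of `A` sends it to something nonnegative; but `(Ax)ᵢ ≤ 0` and `-c(Aξ)ᵢ < 0`.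
  obtain ⟨i, -, hi⟩ := Finset.exists_min_image Finset.univ (fun i => x i / ξ i) ⟨j, Finset.mem_univ j⟩
  set c := x i / ξ i with hc
  have hc0 : c < 0 := (hi j (Finset.mem_univ j)).trans_lt (div_neg_of_neg_of_pos hj (hξ j))
  have hz : ∀ l, 0 ≤ x l - c * ξ l := fun l => by
    have := (le_div_iff₀ (hξ l)).1 (hi l (Finset.mem_univ l))
    linarith
  have hzi : x i - c * ξ i = 0 := by rw [hc]; field_simp [(hξ i).ne']; ring
  have h1 : 0 ≤ (A *ᵥ (x - c • ξ)) i := by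
    refine Finset.sum_nonneg fun l _ => ?_
    rcases eq_or_ne i l with rfl | hil
    · simp [hzi]
    · exact mul_nonneg (hA i l hil) (by simpa using hz l)
  rw [mulVec_sub, mulVec_smul] at h1
  simp only [Pi.sub_apply, Pi.smul_apply, smul_eq_mul] at h1
  nlinarith [hx i, mul_pos_of_neg_of_neg hc0 (hAξ i)]

/-- Inverse monotonicity applied to `v` and `-v` kills the kernel; applied to the columns of `-A⁻¹`
it gives their nonnegativity. -/
theorem exists_nonneg_neg_inverse (hA : IsMetzler A) {ξ : ι → ℝ} (hξ : ∀ i, 0 < ξ i)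
    (hAξ : ∀ i, (A *ᵥ ξ) i < 0) :
    ∃ R : Matrix ι ι ℝ, (∀ i j, 0 ≤ R i j) ∧ A * R = -1 ∧ R * A = -1 := by
  have hdet : IsUnit A.det := by
    rw [isUnit_iff_ne_zero]
    intro h
    obtain ⟨v, hv, hAv⟩ := exists_mulVec_eq_zero_iff.2 h
    apply hv
    have h1 := hA.nonneg_of_mulVec_nonpos hξ hAξ (x := v) (by simp [hAv])
    have h2 := hA.nonneg_of_mulVec_nonpos hξ hAξ (x := -v) (by simp [mulVec_neg, hAv])
    ext i
    exact le_antisymm (by simpa using h2 i) (h1 i)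
  refine ⟨-A⁻¹, fun i j => ?_, by simp [mul_nonsing_inv _ hdet], by simp [nonsing_inv_mul _ hdet]⟩
  have := hA.nonneg_of_mulVec_nonpos hξ hAξ (x := -A⁻¹ *ᵥ Pi.single j 1) (fun l => by
    rw [mulVec_mulVec, mul_neg, mul_nonsing_inv _ hdet]
    by_cases h : l = j <;> simp [h]) i
  simpa [neg_mulVec] using this

end IsMetzler

theorem mem_spectrum_iff_exists_mulVec {ι : Type*} [Fintype ι] [DecidableEq ι]
    {A : Matrix ι ι ℝ} {t : ℝ} :
    t ∈ spectrum ℝ A ↔ ∃ x : ι → ℝ, x ≠ 0 ∧ A *ᵥ x = t • x := by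
  rw [spectrum.mem_iff, Matrix.isUnit_iff_isUnit_det, isUnit_iff_ne_zero, not_not,
    ← exists_mulVec_eq_zero_iff]
  refine exists_congr fun x => and_congr_right fun _ => ?_
  rw [Algebra.algebraMap_eq_smul_one, sub_mulVec, smul_mulVec, one_mulVec, sub_eq_zero, eq_comm]

namespace IsMetzler

variable {ι : Type*} [Fintype ι] [DecidableEq ι] {A : Matrix ι ι ℝ}

/-- A Metzler matrix whose transpose maps some nonzero nonnegative vector to a nonnegative vector
has a nonnegative real eigenvalue. -/
theorem exists_nonneg_mem_spectrum (hA : IsMetzler A) {y : ι → ℝ} (hy : ∀ i, 0 ≤ y i)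
    (hy0 : y ≠ 0) (hAy : ∀ i, 0 ≤ (Aᵀ *ᵥ y) i) : ∃ t, 0 ≤ t ∧ t ∈ spectrum ℝ A := by
  -- The eigenvalue will be `τ = inf T`, a Collatz–Wielandt infimum truncated at `0`. It is not
  -- attained: for `τ > 0` it could be lowered, and for `τ = 0` pairing with `y` gives a
  -- contradiction.
  set T : Set ℝ := {t | 0 ≤ t ∧ ∃ x : ι → ℝ, (∀ i, 0 < x i) ∧ ∀ i, (A *ᵥ x) i < t * x i} with hT
  have hTne : T.Nonempty := by
    refine ⟨∑ i, |(A *ᵥ 1) i| + 1, by positivity, 1, fun i => one_pos, fun i => ?_⟩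
    have := Finset.single_le_sum (f := fun i => |(A *ᵥ 1) i|) (fun i _ => abs_nonneg _)
      (Finset.mem_univ i)
    have h2 := le_abs_self ((A *ᵥ 1) i)
    simp only [Pi.one_apply, mul_one] at this ⊢
    linarith
  have hTbdd : BddBelow T := ⟨0, fun t ht => ht.1⟩
  set τ := sInf T with hτ
  have hτ0 : 0 ≤ τ := le_csInf hTne fun t ht => ht.1
  have hnot : ∀ x : ι → ℝ, (∀ i, 0 < x i) → ¬ ∀ i, (A *ᵥ x) i < τ * x i := by
    intro x hx h
    have hpos : τ ≠ 0 := by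
      intro h0
      have h1 : 0 ≤ (Aᵀ *ᵥ y) ⬝ᵥ x :=
        Finset.sum_nonneg fun i _ => mul_nonneg (hAy i) (hx i).le
      rw [mulVec_transpose, ← dotProduct_mulVec] at h1
      obtain ⟨i, hi⟩ := Function.ne_iff.1 hy0
      have h2 : y ⬝ᵥ (A *ᵥ x) < 0 := by
        refine Finset.sum_neg' (fun j _ => ?_) ⟨i, Finset.mem_univ i, ?_⟩
        · exact mul_nonpos_of_nonneg_of_nonpos (hy j) (by have := h j; rw [h0] at this; linarith)
        · exact mul_neg_of_pos_of_neg (lt_of_le_of_ne (hy i) (Ne.symm hi))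
            (by have := h i; rw [h0] at this; linarith)
      linarith
    have hτpos : 0 < τ := lt_of_le_of_ne hτ0 hpos.symm
    have hev := eventually_add_mul_lt (fun i => x i) h
    obtain ⟨δ, hδ, hδ0, hδτ⟩ := (hev.and (Ioo_mem_nhdsGT hτpos)).exists
    have hmem : τ - δ ∈ T := ⟨by linarith, x, hx, fun i => by have := hδ i; linarith⟩
    have := csInf_le hTbdd hmem
    linarith
  refine ⟨τ, hτ0, ?_⟩
  rw [spectrum.mem_iff, Matrix.isUnit_iff_isUnit_det, isUnit_iff_ne_zero, not_not]
  by_contra hdet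
  set S : ℝ → Matrix ι ι ℝ := fun t => algebraMap ℝ (Matrix ι ι ℝ) t - A with hS
  have hScont : Continuous S := by
    simp only [hS, Algebra.algebraMap_eq_smul_one]
    fun_prop
  have hSdet : Continuous fun t => (S t).det := hScont.matrix_det
  -- Cramer's rule for the solution of `(t - A) w = 1`, chosen so that continuity at `τ` is visible.
  -- Nonnegativity for `t > τ` passes to the limit, and `w τ` then contradicts `hnot` after a small
  -- positive perturbation.
  set w : ℝ → ι → ℝ := fun t => (S t).det⁻¹ • ((S t).adjugate *ᵥ 1) with hw
  have hwcont : ContinuousAt w τ :=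
    (hSdet.continuousAt.inv₀ hdet).smul
      ((hScont.matrix_adjugate.matrix_mulVec continuous_const).continuousAt)
  have hwS : ∀ t, (S t).det ≠ 0 → S t *ᵥ w t = 1 := by
    intro t ht
    rw [hw, mulVec_smul, mulVec_mulVec, mul_adjugate, smul_mulVec, one_mulVec, smul_smul,
      inv_mul_cancel₀ ht, one_smul]
  have hSmul : ∀ t x i, (S t *ᵥ x) i = t * x i - (A *ᵥ x) i := by
    intro t x i
    simp [hS, Algebra.algebraMap_eq_smul_one, sub_mulVec, smul_mulVec]
  have hwnonneg : ∀ t, τ < t → (S t).det ≠ 0 → ∀ i, 0 ≤ w t i := by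
    intro t ht hd
    obtain ⟨r, ⟨hr0, x, hx, hAx⟩, hrt⟩ := exists_lt_of_csInf_lt hTne ht
    have hM : IsMetzler (A + (-t) • (1 : Matrix ι ι ℝ)) := hA.add_smul_one _
    have hmv : ∀ (x : ι → ℝ) i, ((A + (-t) • (1 : Matrix ι ι ℝ)) *ᵥ x) i = -(S t *ᵥ x) i := by
      intro x i
      rw [hSmul, add_mulVec, smul_mulVec, one_mulVec]
      simp only [Pi.add_apply, Pi.smul_apply, smul_eq_mul]
      ring
    refine hM.nonneg_of_mulVec_nonpos hx (fun i => ?_) (fun i => ?_)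
    · rw [hmv, hSmul]
      nlinarith [hAx i, hx i]
    · rw [hmv, hwS t hd]
      simp
  have hw0 : ∀ i, 0 ≤ w τ i := by
    intro i
    have hc : Filter.Tendsto (fun t => w t i) (nhdsWithin τ (Set.Ioi τ)) (nhds (w τ i)) :=
      ((continuous_apply i).continuousAt.comp hwcont).tendsto.mono_left nhdsWithin_le_nhds
    refine ge_of_tendsto hc ?_
    have hd : ∀ᶠ t in nhds τ, (S t).det ≠ 0 := hSdet.continuousAt.eventually_ne hdet
    filter_upwards [hd.filter_mono nhdsWithin_le_nhds, self_mem_nhdsWithin] with t h1 h2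
    exact hwnonneg t h2 h1 i
  have hlt : ∀ i, (A *ᵥ w τ) i - τ * w τ i < 0 := by
    intro i
    have := congrFun (hwS τ hdet) i
    rw [hSmul] at this
    simp only [Pi.one_apply] at this
    linarith
  obtain ⟨δ, hδ, hδ0⟩ := ((eventually_add_mul_lt (fun i => (A *ᵥ 1) i - τ) hlt).and
    self_mem_nhdsWithin).exists
  refine hnot (w τ + δ • 1) (fun i => ?_) fun i => ?_
  · have := hw0 i
    have : 0 < δ := hδ0
    simp only [Pi.add_apply, Pi.smul_apply, Pi.one_apply, smul_eq_mul]
    linarith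
  · have := hδ i
    simp only [mulVec_add, mulVec_smul, Pi.add_apply, Pi.smul_apply, Pi.one_apply, smul_eq_mul]
    linarith

theorem exists_pos_mulVec_neg (hA : IsMetzler A) (h : ∀ t ∈ spectrum ℝ A, t < 0) :
    ∃ x : ι → ℝ, (∀ i, 0 < x i) ∧ ∀ i, (A *ᵥ x) i < 0 := by
  rcases exists_nonneg_transpose_or_exists_pos_neg A with ⟨y, hy, hy0, hAy⟩ | hx
  · obtain ⟨t, ht, hts⟩ := hA.exists_nonneg_mem_spectrum hy hy0 hAy
    exact absurd (h t hts) (not_lt.2 ht)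
  · exact hx

/-- After shifting by a large `c`, all column sums are nonnegative, so the all-ones vector serves as
`y`. -/
theorem spectrum_nonempty [Nonempty ι] (hA : IsMetzler A) : (spectrum ℝ A).Nonempty := by
  set c : ℝ := ∑ i, |(Aᵀ *ᵥ 1) i| with hc
  obtain ⟨t, -, ht⟩ := (hA.add_smul_one c).exists_nonneg_mem_spectrum (y := 1)
    (fun _ => zero_le_one) one_ne_zero (fun i => by
      have h1 := Finset.single_le_sum (f := fun i => |(Aᵀ *ᵥ 1) i|) (fun i _ => abs_nonneg _)
        (Finset.mem_univ i)
      have h2 := neg_abs_le ((Aᵀ *ᵥ 1) i)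
      simp only [transpose_add, transpose_smul, transpose_one, add_mulVec, smul_mulVec,
        one_mulVec, Pi.add_apply, Pi.smul_apply, Pi.one_apply, smul_eq_mul, mul_one]
      linarith)
  obtain ⟨x, hx, hAx⟩ := mem_spectrum_iff_exists_mulVec.1 ht
  refine ⟨t - c, mem_spectrum_iff_exists_mulVec.2 ⟨x, hx, ?_⟩⟩
  rw [add_mulVec, smul_mulVec, one_mulVec] at hAx
  rw [sub_smul, ← hAx, add_sub_cancel_right]

end IsMetzler

/-! ### Norm bounds, block weights and the Schur test -/

theorem sum_sq_mulVec_le_of_twoNorm_le {ι : Type*} [Fintype ι] [DecidableEq ι] {Δ : Matrix ι ι ℝ}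
    {ε : ℝ} (hΔ : twoNorm Δ ≤ ε) (x : ι → ℝ) :
    ∑ i, (Δ *ᵥ x) i ^ 2 ≤ ε ^ 2 * ∑ i, x i ^ 2 := by
  have h := (toEuclideanCLM (n := ι) (𝕜 := ℝ) Δ).le_of_opNorm_le hΔ (WithLp.toLp 2 x)
  rw [toEuclideanCLM_toLp] at h
  have h2 := pow_le_pow_left₀ (norm_nonneg _) h 2
  rw [mul_pow, EuclideanSpace.real_norm_sq_eq, EuclideanSpace.real_norm_sq_eq] at h2
  exact h2

theorem twoNorm_le_of_sum_sq_mulVec_le {ι : Type*} [Fintype ι] [DecidableEq ι] {Δ : Matrix ι ι ℝ}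
    {ε : ℝ} (hε : 0 ≤ ε) (h : ∀ x : ι → ℝ, ∑ i, (Δ *ᵥ x) i ^ 2 ≤ ε ^ 2 * ∑ i, x i ^ 2) :
    twoNorm Δ ≤ ε := by
  refine ContinuousLinearMap.opNorm_le_bound _ hε fun x => ?_
  refine le_of_sq_le_sq ?_ (by positivity)
  rw [mul_pow, EuclideanSpace.real_norm_sq_eq, EuclideanSpace.real_norm_sq_eq]
  simpa only [ofLp_toEuclideanCLM] using h x.ofLp

/-- Block-diagonal matrices of norm at most `ε` also contract block-weighted norms by `ε`. -/
theorem weighted_sum_sq_mulVec_le {ι κ : Type*} [Fintype ι] [DecidableEq ι] {blk : ι → κ}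
    {Δ : Matrix ι ι ℝ} {ε : ℝ} (hΔ : twoNorm Δ ≤ ε) (hblk : ∀ i j, blk i ≠ blk j → Δ i j = 0)
    {p : κ → ℝ} (hp : ∀ k, 0 < p k) (x : ι → ℝ) :
    ∑ i, p (blk i) * (Δ *ᵥ x) i ^ 2 ≤ ε ^ 2 * ∑ i, p (blk i) * x i ^ 2 := by
  -- The weight `√p` is constant on blocks, hence commutes with `Δ`.
  have h := sum_sq_mulVec_le_of_twoNorm_le hΔ fun i => √(p (blk i)) * x i
  have hcomm : ∀ i, (Δ *ᵥ fun i => √(p (blk i)) * x i) i = √(p (blk i)) * (Δ *ᵥ x) i := by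
    intro i
    simp only [mulVec, dotProduct, Finset.mul_sum]
    refine Finset.sum_congr rfl fun j _ => ?_
    by_cases hij : blk i = blk j
    · rw [hij]; ring
    · simp [hblk i j hij]
  simpa only [hcomm, mul_pow, Real.sq_sqrt (hp _).le] using h

theorem mulVec_mono {ι : Type*} [Fintype ι] {M : Matrix ι ι ℝ} (hM : ∀ i j, 0 ≤ M i j)
    {x y : ι → ℝ} (hxy : ∀ i, x i ≤ y i) (i : ι) : (M *ᵥ x) i ≤ (M *ᵥ y) i :=
  Finset.sum_le_sum fun j _ => mul_le_mul_of_nonneg_left (hxy j) (hM i j)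

theorem mulVec_nonneg_of_nonneg {ι : Type*} [Fintype ι] {M : Matrix ι ι ℝ}
    (hM : ∀ i j, 0 ≤ M i j) {x : ι → ℝ} (hx : ∀ i, 0 ≤ x i) (i : ι) : 0 ≤ (M *ᵥ x) i :=
  Finset.sum_nonneg fun j _ => mul_nonneg (hM i j) (hx j)

theorem abs_mulVec_le {ι : Type*} [Fintype ι] {M : Matrix ι ι ℝ} (hM : ∀ i j, 0 ≤ M i j)
    (x : ι → ℝ) (i : ι) : |(M *ᵥ x) i| ≤ (M *ᵥ |x|) i := by
  refine (Finset.abs_sum_le_sum_abs _ _).trans (Finset.sum_le_sum fun j _ => ?_)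
  rw [abs_mul, abs_of_nonneg (hM i j), Pi.abs_apply]

theorem matrix_mul_nonneg {ι : Type*} [Fintype ι] {M N : Matrix ι ι ℝ} (hM : ∀ i j, 0 ≤ M i j)
    (hN : ∀ i j, 0 ≤ N i j) (i j : ι) : 0 ≤ (M * N) i j :=
  Finset.sum_nonneg fun l _ => mul_nonneg (hM i l) (hN l j)

/-- A Schur test with weights: two coupled positive test vectors bound the weighted norm of a
nonnegative matrix. -/
theorem weighted_contraction {ι : Type*} [Fintype ι] {M : Matrix ι ι ℝ} (hM : ∀ i j, 0 ≤ M i j)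
    {ε : ℝ} (hε : 0 < ε) {p U V : ι → ℝ} (hU : ∀ i, 0 < U i)
    (hV : ∀ i, ε * (p i * (M *ᵥ U) i) < V i) (hMV : ∀ i, ε * (Mᵀ *ᵥ V) i < p i * U i)
    (hp : ∀ i, 0 < p i) {z : ι → ℝ} (hz : z ≠ 0) :
    ε ^ 2 * ∑ i, p i * (M *ᵥ z) i ^ 2 < ∑ i, p i * z i ^ 2 := by
  -- Cauchy–Schwarz with the splitting `(M z)² = (MU) · (M z²/U)` in each entry.
  have hcs : ∀ i, (M *ᵥ z) i ^ 2 ≤ (M *ᵥ U) i * ∑ j, M i j * (z j ^ 2 / U j) := fun i =>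
    Finset.sum_sq_le_sum_mul_sum_of_sq_le_mul _ (fun j _ => mul_nonneg (hM i j) (hU j).le)
      (fun j _ => mul_nonneg (hM i j) (div_nonneg (sq_nonneg _) (hU j).le))
      (fun j _ => le_of_eq (by have := (hU j).ne'; field_simp))
  calc ε ^ 2 * ∑ i, p i * (M *ᵥ z) i ^ 2
      ≤ ∑ i, ε * V i * ∑ j, M i j * (z j ^ 2 / U j) := by
        rw [Finset.mul_sum]
        refine Finset.sum_le_sum fun i _ => ?_
        have hS : 0 ≤ ∑ j, M i j * (z j ^ 2 / U j) := Finset.sum_nonneg fun j _ =>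
          mul_nonneg (hM i j) (div_nonneg (sq_nonneg _) (hU j).le)
        calc ε ^ 2 * (p i * (M *ᵥ z) i ^ 2)
            ≤ ε ^ 2 * (p i * ((M *ᵥ U) i * ∑ j, M i j * (z j ^ 2 / U j))) := by
              have := hcs i
              have := (hp i).le
              gcongr
          _ = ε * (ε * (p i * (M *ᵥ U) i)) * ∑ j, M i j * (z j ^ 2 / U j) := by ring
          _ ≤ ε * V i * ∑ j, M i j * (z j ^ 2 / U j) := by
              have := (hV i).le
              gcongr
    _ = ∑ j, ε * (Mᵀ *ᵥ V) j * (z j ^ 2 / U j) := by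
        simp only [mulVec, dotProduct, transpose_apply, Finset.mul_sum, Finset.sum_mul]
        rw [Finset.sum_comm]
        refine Finset.sum_congr rfl fun j _ => Finset.sum_congr rfl fun i _ => by ring
    _ < ∑ j, p j * z j ^ 2 := by
        have key : ∀ j, p j * z j ^ 2 = p j * U j * (z j ^ 2 / U j) := fun j => by
          have := (hU j).ne'; field_simp
        simp only [key]
        obtain ⟨j, hj⟩ := Function.ne_iff.1 hz
        refine Finset.sum_lt_sum (fun j _ => ?_) ⟨j, Finset.mem_univ j, ?_⟩
        · exact mul_le_mul_of_nonneg_right (hMV j).le (div_nonneg (sq_nonneg _) (hU j).le)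
        · exact mul_lt_mul_of_pos_right (hMV j) (div_pos (by have : z j ≠ 0 := hj; positivity) (hU j))

/-! ### Certificates force a negative real spectrum -/

/-- Feasibility of the four inequalities after absorbing the square roots of the scaling matrix into
the vectors `u` and `ν`. -/
def Certified {ι κ : Type*} [Fintype ι] (blk : ι → κ) (A B F : Matrix ι ι ℝ) (ε : ℝ) : Prop :=
  ∃ (U V ξ ζ : ι → ℝ) (p : κ → ℝ), (∀ k, 0 < p k) ∧
    (∀ i, 0 < U i) ∧ (∀ i, 0 < V i) ∧ (∀ i, 0 < ξ i) ∧ (∀ i, 0 < ζ i) ∧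
    (∀ i, √ε * (p (blk i) * (F *ᵥ ξ) i) < V i) ∧
    (∀ i, (A *ᵥ ξ) i + √ε * (B *ᵥ U) i < 0) ∧
    (∀ i, √ε * (Bᵀ *ᵥ ζ) i < p (blk i) * U i) ∧
    (∀ i, (Aᵀ *ᵥ ζ) i + √ε * (Fᵀ *ᵥ V) i < 0)

theorem mulVec_neg_inverse {ι : Type*} [Fintype ι] [DecidableEq ι] {R A : Matrix ι ι ℝ}
    (hRA : R * A = -1) (x : ι → ℝ) : R *ᵥ (A *ᵥ x) = -x := by
  rw [mulVec_mulVec, hRA, neg_mulVec, one_mulVec]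

/-- If a nonnegative `R` satisfies `R A = -1`, then `A x + y ≤ 0` yields `R y ≤ x`. -/
theorem mulVec_le_of_neg_inverse {ι : Type*} [Fintype ι] [DecidableEq ι] {R A : Matrix ι ι ℝ}
    (hR : ∀ i j, 0 ≤ R i j) (hRA : R * A = -1) {x y : ι → ℝ}
    (h : ∀ i, (A *ᵥ x) i + y i ≤ 0) (i : ι) : (R *ᵥ y) i ≤ x i := by
  have h1 := mulVec_mono hR (x := A *ᵥ x + y) (y := 0) h i
  rw [mulVec_add, mulVec_neg_inverse hRA, mulVec_zero] at h1
  simp only [Pi.add_apply, Pi.neg_apply, Pi.zero_apply] at h1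
  linarith

/-- For an eigenvector `x` of `A + N` with eigenvalue `t ≥ 0`, `A` Metzler and `N` nonnegative,
the vector of absolute values is subharmonic. -/
theorem IsMetzler.abs_eigenvector {ι : Type*} [Fintype ι] [DecidableEq ι] {A N : Matrix ι ι ℝ}
    (hA : IsMetzler A) (hN : ∀ i j, 0 ≤ N i j) {t : ℝ} (ht : 0 ≤ t) {x : ι → ℝ}
    (hx : (A + N) *ᵥ x = t • x) (i : ι) : 0 ≤ (A *ᵥ |x|) i + (N *ᵥ |x|) i := by
  have hi := congrFun hx i
  rw [add_mulVec, Pi.add_apply, Pi.smul_apply, smul_eq_mul] at hi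
  have hsplit : ∀ y : ι → ℝ, (A *ᵥ y) i = A i i * y i + ∑ j ∈ Finset.univ.erase i, A i j * y j :=
    fun y => (Finset.add_sum_erase _ (fun j => A i j * y j) (Finset.mem_univ i)).symm
  have hoff : |∑ j ∈ Finset.univ.erase i, A i j * x j| ≤
      ∑ j ∈ Finset.univ.erase i, A i j * |x| j := by
    refine (Finset.abs_sum_le_sum_abs _ _).trans (Finset.sum_le_sum fun j hj => ?_)
    rw [abs_mul, abs_of_nonneg (hA i j (Finset.ne_of_mem_erase hj).symm), Pi.abs_apply]
  have hNx := abs_mulVec_le hN x i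
  rw [hsplit] at hi ⊢
  have heq : (t - A i i) * x i = (∑ j ∈ Finset.univ.erase i, A i j * x j) + (N *ᵥ x) i := by
    linarith
  have h1 : (t - A i i) * |x i| ≤ |(t - A i i) * x i| := by
    rw [abs_mul]
    exact mul_le_mul_of_nonneg_right (le_abs_self _) (abs_nonneg _)
  have h2 := abs_add_le (∑ j ∈ Finset.univ.erase i, A i j * x j) ((N *ᵥ x) i)
  rw [heq] at h1
  have h3 := mul_nonneg ht (abs_nonneg (x i))
  rw [Pi.abs_apply] at *
  linarith

/-- A certificate excludes nonnegative real eigenvalues for every admissible perturbation. -/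
theorem Certified.spectrum_neg {ι κ : Type*} [Fintype ι] [DecidableEq ι] {blk : ι → κ}
    {A B F : Matrix ι ι ℝ} {ε : ℝ} (h : Certified blk A B F ε) (hA : IsMetzler A)
    (hB : ∀ i j, 0 ≤ B i j) (hF : ∀ i j, 0 ≤ F i j) (hε : 0 < ε) {Δ : Matrix ι ι ℝ}
    (hΔ0 : ∀ i j, 0 ≤ Δ i j) (hΔ : twoNorm Δ ≤ ε) (hblk : ∀ i j, blk i ≠ blk j → Δ i j = 0)
    {t : ℝ} (ht : t ∈ spectrum ℝ (A + B * Δ * F)) : t < 0 := by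
  obtain ⟨U, V, ξ, ζ, p, hp, hU, hV, hξ, hζ, h1, h2, h3, h4⟩ := h
  by_contra! ht0
  obtain ⟨x, hx, hAx⟩ := mem_spectrum_iff_exists_mulVec.1 ht
  have hs : 0 < √ε := Real.sqrt_pos.2 hε
  have hAξ : ∀ i, (A *ᵥ ξ) i < 0 := fun i => by
    have := mul_nonneg hs.le (mulVec_nonneg_of_nonneg hB (fun i => (hU i).le) i)
    linarith [h2 i]
  obtain ⟨R, hR, hAR, hRA⟩ := hA.exists_nonneg_neg_inverse hξ hAξ
  have hBt : ∀ i j, 0 ≤ Bᵀ i j := fun i j => hB j i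
  have hRt : ∀ i j, 0 ≤ Rᵀ i j := fun i j => hR j i
  have hRAt : Rᵀ * Aᵀ = -1 := by rw [← transpose_mul, hAR]; simp
  have hM := matrix_mul_nonneg (matrix_mul_nonneg hF hR) hB
  set M := F * R * B with hMdef
  have hMv : ∀ v, M *ᵥ v = F *ᵥ (R *ᵥ (B *ᵥ v)) := fun v => by simp [hMdef, Matrix.mul_assoc]
  have hMtv : ∀ v, Mᵀ *ᵥ v = Bᵀ *ᵥ (Rᵀ *ᵥ (Fᵀ *ᵥ v)) := fun v => by
    simp [hMdef, Matrix.mul_assoc, transpose_mul]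
  have hMU : ∀ i, ε * (p (blk i) * (M *ᵥ U) i) < V i := fun i => by
    have ha := mulVec_mono hF (mulVec_le_of_neg_inverse hR hRA (y := √ε • (B *ᵥ U))
      (fun i => (h2 i).le)) i
    rw [mulVec_smul, mulVec_smul, ← hMv, Pi.smul_apply, smul_eq_mul] at ha
    refine lt_of_le_of_lt ?_ (h1 i)
    calc ε * (p (blk i) * (M *ᵥ U) i) = √ε * (p (blk i) * (√ε * (M *ᵥ U) i)) := by
          nth_rw 1 [← Real.mul_self_sqrt hε.le]; ring
      _ ≤ _ := by have := (hp (blk i)).le; gcongr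
  have hMV : ∀ i, ε * (Mᵀ *ᵥ V) i < p (blk i) * U i := fun i => by
    have ha := mulVec_mono hBt (mulVec_le_of_neg_inverse hRt hRAt (y := √ε • (Fᵀ *ᵥ V))
      (fun i => (h4 i).le)) i
    rw [mulVec_smul, mulVec_smul, ← hMtv, Pi.smul_apply, smul_eq_mul] at ha
    refine lt_of_le_of_lt ?_ (h3 i)
    calc ε * (Mᵀ *ᵥ V) i = √ε * (√ε * (Mᵀ *ᵥ V) i) := by
          nth_rw 1 [← Real.mul_self_sqrt hε.le]; ring
      _ ≤ _ := by gcongr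
  -- Absolute values turn the eigenvector equation into `Ay + Bz ≥ 0`; applying `R ≥ 0` gives `y ≤
  -- RBz`, hence `z ≤ ΔMz`.
  set y := |x| with hy
  set z := Δ *ᵥ (F *ᵥ y) with hz
  have hy0 : ∀ i, 0 ≤ y i := fun i => abs_nonneg _
  have hz0 : ∀ i, 0 ≤ z i := mulVec_nonneg_of_nonneg hΔ0 (mulVec_nonneg_of_nonneg hF hy0)
  have hsub : ∀ i, 0 ≤ (A *ᵥ y) i + (B *ᵥ z) i := fun i => by
    have := hA.abs_eigenvector (matrix_mul_nonneg (matrix_mul_nonneg hB hΔ0) hF) ht0 hAx i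
    simpa [hz, Matrix.mul_assoc] using this
  have hyR : ∀ i, y i ≤ (R *ᵥ (B *ᵥ z)) i := fun i => by
    have := mulVec_mono hR (x := 0) (y := A *ᵥ y + B *ᵥ z) hsub i
    rw [mulVec_zero, mulVec_add, mulVec_neg_inverse hRA] at this
    simp only [Pi.add_apply, Pi.neg_apply, Pi.zero_apply] at this
    linarith
  have hzM : ∀ i, z i ≤ (Δ *ᵥ (M *ᵥ z)) i := fun i => by
    rw [hMv]
    exact mulVec_mono hΔ0 (mulVec_mono hF hyR) i
  have hzne : z ≠ 0 := by
    intro h0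
    apply hx
    ext i
    have := hyR i
    rw [h0, mulVec_zero, mulVec_zero] at this
    exact abs_nonpos_iff.1 this
  have hc := weighted_contraction hM hε hU hMU hMV (fun i => hp (blk i)) hzne
  have hw := weighted_sum_sq_mulVec_le hΔ hblk hp (M *ᵥ z)
  have hle : ∑ i, p (blk i) * z i ^ 2 ≤ ∑ i, p (blk i) * (Δ *ᵥ (M *ᵥ z)) i ^ 2 :=
    Finset.sum_le_sum fun i _ => mul_le_mul_of_nonneg_left
      (pow_le_pow_left₀ (hz0 i) (hzM i) 2) (hp _).le
  linarith

/-! ### From a negative spectrum to a certificate -/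

/-- Existence of a block scaling: if no nonnegative `q ≠ 0` satisfies
`∑_{blk i = k} qᵢ² ≤ ε² ∑_{blk i = k} (M q)ᵢ²` for all `k`, then a single block scaling works. -/
theorem exists_block_growth_or_exists_scaling {ι κ : Type*} [Fintype ι] [DecidableEq ι]
    [Fintype κ] [DecidableEq κ] (blk : ι → κ) {M : Matrix ι ι ℝ} (hM : ∀ i j, 0 ≤ M i j) (ε : ℝ) :
    (∃ q : ι → ℝ, (∀ i, 0 ≤ q i) ∧ q ≠ 0 ∧ ∀ k, ∑ i with blk i = k, q i ^ 2 ≤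
      ε ^ 2 * ∑ i with blk i = k, (M *ᵥ q) i ^ 2) ∨
    ∃ p : κ → ℝ, (∀ k, 0 < p k) ∧ ∀ q : ι → ℝ, (∀ i, 0 ≤ q i) → q ≠ 0 →
      ε ^ 2 * ∑ i, p (blk i) * (M *ᵥ q) i ^ 2 < ∑ i, p (blk i) * q i ^ 2 := by
  -- The substitution `s = q²` makes `(Mq)ᵢ²` a nonnegative combination of geometric means `√(sⱼ
  -- sₗ)`, which are concave.
  set f : (ι → ℝ) → κ → ℝ := fun s k =>
    ∑ i with blk i = k, (ε ^ 2 * (M *ᵥ fun j => √(s j)) i ^ 2 - s i) with hf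
  have hcont : Continuous f := by
    refine continuous_pi fun k => continuous_finsetSum _ fun i _ => ?_
    refine (continuous_const.mul (Continuous.pow ?_ 2)).sub (continuous_apply i)
    exact (continuous_apply i).comp (Continuous.matrix_mulVec continuous_const
      (continuous_pi fun j => Real.continuous_sqrt.comp (continuous_apply j)))
  have hexp : ∀ (s : ι → ℝ) i, (M *ᵥ fun j => √(s j)) i ^ 2 =
      ∑ j, ∑ l, M i j * M i l * (√(s j) * √(s l)) := by
    intro s i
    rw [sq]
    simp only [mulVec, dotProduct]
    rw [Finset.sum_mul_sum]
    exact Finset.sum_congr rfl fun j _ => Finset.sum_congr rfl fun l _ => by ring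
  have hsqrt : ∀ a b c d : ℝ, 0 ≤ a → 0 ≤ b → 0 ≤ c → 0 ≤ d →
      √a * √b + √c * √d ≤ √(a + c) * √(b + d) := by
    intro a b c d ha hb hc hd
    rw [← Real.sqrt_mul (add_nonneg ha hc)]
    refine Real.le_sqrt_of_sq_le ?_
    have h1 := Real.sq_sqrt ha
    have h2 := Real.sq_sqrt hb
    have h3 := Real.sq_sqrt hc
    have h4 := Real.sq_sqrt hd
    calc (√a * √b + √c * √d) ^ 2 ≤ (√a ^ 2 + √c ^ 2) * (√b ^ 2 + √d ^ 2) := by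
          nlinarith [sq_nonneg (√a * √d - √c * √b)]
      _ = _ := by rw [h1, h2, h3, h4]
  have hconc : ∀ k, ConcaveOn ℝ (stdSimplex ℝ ι) fun s => f s k := by
    refine fun k => ⟨convex_stdSimplex ℝ ι, fun s hs t ht a b ha hb _ => ?_⟩
    simp only [hf, smul_eq_mul, Finset.mul_sum, ← Finset.sum_add_distrib]
    refine Finset.sum_le_sum fun i _ => ?_
    have hkey : a * (M *ᵥ fun j => √(s j)) i ^ 2 + b * (M *ᵥ fun j => √(t j)) i ^ 2 ≤
        (M *ᵥ fun j => √((a • s + b • t) j)) i ^ 2 := by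
      simp only [hexp, Finset.mul_sum, ← Finset.sum_add_distrib]
      refine Finset.sum_le_sum fun j _ => Finset.sum_le_sum fun l _ => ?_
      have h1 := hsqrt (a * s j) (a * s l) (b * t j) (b * t l) (mul_nonneg ha (hs.1 j))
        (mul_nonneg ha (hs.1 l)) (mul_nonneg hb (ht.1 j)) (mul_nonneg hb (ht.1 l))
      rw [Real.sqrt_mul ha, Real.sqrt_mul ha, Real.sqrt_mul hb, Real.sqrt_mul hb] at h1
      have h2 := Real.mul_self_sqrt ha
      have h3 := Real.mul_self_sqrt hb
      calc a * (M i j * M i l * (√(s j) * √(s l))) + b * (M i j * M i l * (√(t j) * √(t l)))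
          = M i j * M i l * (√a * √(s j) * (√a * √(s l)) + √b * √(t j) * (√b * √(t l))) := by
            nth_rw 1 [← h2, ← h3]; ring
        _ ≤ _ := mul_le_mul_of_nonneg_left h1 (mul_nonneg (hM i j) (hM i l))
    have := mul_le_mul_of_nonneg_left hkey (sq_nonneg ε)
    simp only [Pi.add_apply, Pi.smul_apply, smul_eq_mul] at this ⊢
    linarith
  rcases exists_nonneg_or_exists_pos_weights f hcont hconc with ⟨s, hs, h⟩ | ⟨p, hp, h⟩
  · refine Or.inl ⟨fun j => √(s j), fun j => Real.sqrt_nonneg _, ?_, fun k => ?_⟩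
    · intro h0
      have : ∀ j, s j = 0 := fun j => (Real.sqrt_eq_zero (hs.1 j)).1 (congrFun h0 j)
      simpa [this] using hs.2
    · have := h k
      simp only [hf, Finset.sum_sub_distrib, ← Finset.mul_sum] at this
      simp only [Real.sq_sqrt (hs.1 _)]
      linarith
  · refine Or.inr ⟨p, hp, fun q hq hq0 => ?_⟩
    set c := ∑ j, q j ^ 2 with hc
    have hc0 : 0 < c := by
      obtain ⟨j, hj⟩ := Function.ne_iff.1 hq0
      exact Finset.sum_pos' (fun _ _ => sq_nonneg _) ⟨j, Finset.mem_univ j, pow_pos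
        (lt_of_le_of_ne (hq j) (Ne.symm hj)) 2⟩
    have hmem : (fun j => q j ^ 2 / c) ∈ stdSimplex ℝ ι :=
      ⟨fun j => by positivity, by rw [← Finset.sum_div, div_self hc0.ne']⟩
    have hneg := h _ hmem
    have hroot : (fun j => √(q j ^ 2 / c)) = (√c)⁻¹ • q := by
      ext j
      rw [Real.sqrt_div (sq_nonneg _), Real.sqrt_sq (hq j)]
      simp [div_eq_inv_mul]
    have hsum : ∑ k, p k * f (fun j => q j ^ 2 / c) k =
        (ε ^ 2 * ∑ i, p (blk i) * (M *ᵥ q) i ^ 2 - ∑ i, p (blk i) * q i ^ 2) / c := by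
      simp only [hf, hroot, mulVec_smul, Pi.smul_apply, smul_eq_mul, mul_pow, inv_pow,
        Real.sq_sqrt hc0.le]
      rw [Finset.mul_sum, ← Finset.sum_sub_distrib, Finset.sum_div,
        ← Finset.sum_fiberwise (s := Finset.univ) (g := blk)]
      refine Finset.sum_congr rfl fun k _ => ?_
      rw [Finset.mul_sum]
      refine Finset.sum_congr rfl fun i hi => ?_
      rw [(Finset.mem_filter.1 hi).2]
      field_simp
    rw [hsum, div_neg_iff] at hneg
    rcases hneg with ⟨-, h'⟩ | ⟨h', -⟩
    · exact absurd h' (not_lt.2 hc0.le)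
    · linarith

/-- A nonnegative block-diagonal matrix with rank-one blocks that maps `w` to `q`. -/
theorem exists_blockDiagonal_mulVec_eq {ι κ : Type*} [Fintype ι] [DecidableEq ι] [Fintype κ]
    [DecidableEq κ] (blk : ι → κ) {q w : ι → ℝ} {ε : ℝ} (hε : 0 ≤ ε) (hq : ∀ i, 0 ≤ q i)
    (hw : ∀ i, 0 ≤ w i)
    (h : ∀ k, ∑ i with blk i = k, q i ^ 2 ≤ ε ^ 2 * ∑ i with blk i = k, w i ^ 2) :
    ∃ Δ : Matrix ι ι ℝ, (∀ i j, 0 ≤ Δ i j) ∧ (∀ i j, blk i ≠ blk j → Δ i j = 0) ∧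
      twoNorm Δ ≤ ε ∧ Δ *ᵥ w = q := by
  set S : κ → ℝ := fun k => ∑ i with blk i = k, w i ^ 2 with hS
  have hS0 : ∀ k, 0 ≤ S k := fun k => Finset.sum_nonneg fun i _ => sq_nonneg _
  -- Block `k` is `q_k w_kᵀ / ‖w_k‖²`. If `w_k = 0`, the division yields `0`, which is right because
  -- `h` then forces `q_k = 0`.
  set Δ : Matrix ι ι ℝ := of fun i j => if blk j = blk i then q i / S (blk i) * w j else 0 with hΔ
  have hmul : ∀ (x : ι → ℝ) i, (Δ *ᵥ x) i = q i / S (blk i) * ∑ j with blk j = blk i, w j * x j := by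
    intro x i
    rw [Finset.mul_sum, Finset.sum_filter]
    refine Finset.sum_congr rfl fun j _ => ?_
    by_cases hij : blk j = blk i <;> simp [hΔ, hij, mul_assoc]
  refine ⟨Δ, fun i j => ?_, fun i j hij => by simp [hΔ, hij.symm], ?_, ?_⟩
  · by_cases hij : blk j = blk i
    · simpa [hΔ, hij] using mul_nonneg (div_nonneg (hq i) (hS0 _)) (hw j)
    · simp [hΔ, hij]
  · refine twoNorm_le_of_sum_sq_mulVec_le hε fun x => ?_
    rw [← Finset.sum_fiberwise (s := Finset.univ) (g := blk),
      ← Finset.sum_fiberwise (s := Finset.univ) (g := blk) (f := fun i => x i ^ 2),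
      Finset.mul_sum]
    refine Finset.sum_le_sum fun k _ => ?_
    set c := ∑ j with blk j = k, w j * x j with hc
    have hcs : c ^ 2 ≤ S k * ∑ i with blk i = k, x i ^ 2 := Finset.sum_mul_sq_le_sq_mul_sq _ _ _
    have hX : 0 ≤ ∑ i with blk i = k, x i ^ 2 := Finset.sum_nonneg fun i _ => sq_nonneg _
    have heq : ∑ i with blk i = k, (Δ *ᵥ x) i ^ 2 =
        (∑ i with blk i = k, q i ^ 2) * (c ^ 2 / S k ^ 2) := by
      rw [Finset.sum_mul]
      refine Finset.sum_congr rfl fun i hi => ?_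
      rw [hmul, (Finset.mem_filter.1 hi).2, ← hc]
      ring
    rw [heq]
    rcases (hS0 k).eq_or_lt with h0 | h0
    · rw [← h0]
      simpa using mul_nonneg (sq_nonneg ε) hX
    · calc (∑ i with blk i = k, q i ^ 2) * (c ^ 2 / S k ^ 2)
          ≤ ε ^ 2 * S k * (S k * (∑ i with blk i = k, x i ^ 2) / S k ^ 2) := by
            have := h k
            gcongr
        _ = ε ^ 2 * ∑ i with blk i = k, x i ^ 2 := by field_simp
  · ext i
    have hSi : ∑ j with blk j = blk i, w j * w j = S (blk i) := by simp [hS, sq]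
    rw [hmul, hSi]
    rcases (hS0 (blk i)).eq_or_lt with h0 | h0
    · have h1 := h (blk i)
      have h2 : q i ^ 2 ≤ ∑ j with blk j = blk i, q j ^ 2 :=
        Finset.single_le_sum (f := fun j => q j ^ 2) (fun j _ => sq_nonneg _) (by simp)
      have h3 : ∑ j with blk j = blk i, w j ^ 2 = 0 := h0.symm
      rw [h3, mul_zero] at h1
      have hqi : q i = 0 := pow_eq_zero_iff two_ne_zero |>.1 (le_antisymm (h2.trans h1) (sq_nonneg _))
      simp [hqi]
    · exact div_mul_cancel₀ _ h0.ne'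

theorem mem_spectrum_transpose {ι : Type*} [Fintype ι] [DecidableEq ι] {A : Matrix ι ι ℝ} {t : ℝ} :
    t ∈ spectrum ℝ Aᵀ ↔ t ∈ spectrum ℝ A := by
  rw [spectrum.mem_iff, spectrum.mem_iff, isUnit_iff_isUnit_det, isUnit_iff_isUnit_det,
    ← det_transpose, Algebra.algebraMap_eq_smul_one]
  simp

/-- If every admissible perturbation leaves the real spectrum negative, a certificate exists. -/
theorem certified_of_spectrum_neg {ι κ : Type*} [Fintype ι] [DecidableEq ι] [Fintype κ]
    [DecidableEq κ] {blk : ι → κ} {A B F : Matrix ι ι ℝ} {ε : ℝ} (hA : IsMetzler A)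
    (hB : ∀ i j, 0 ≤ B i j) (hF : ∀ i j, 0 ≤ F i j) (hε : 0 < ε)
    (h : ∀ Δ : Matrix ι ι ℝ, (∀ i j, 0 ≤ Δ i j) → (∀ i j, blk i ≠ blk j → Δ i j = 0) →
      twoNorm Δ ≤ ε → ∀ t ∈ spectrum ℝ (A + B * Δ * F), t < 0) :
    Certified blk A B F ε := by
  have hspec : ∀ t ∈ spectrum ℝ A, t < 0 := by
    have := h 0 (by simp) (by simp) (by simpa [twoNorm] using hε.le)
    simpa using this
  obtain ⟨ξ₀, hξ₀, hAξ₀⟩ := hA.exists_pos_mulVec_neg hspec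
  obtain ⟨ζ₀, hζ₀, hAζ₀⟩ := hA.transpose.exists_pos_mulVec_neg
    fun t ht => hspec t (mem_spectrum_transpose.1 ht)
  obtain ⟨R, hR, hAR, hRA⟩ := hA.exists_nonneg_neg_inverse hξ₀ hAξ₀
  have hM := matrix_mul_nonneg (matrix_mul_nonneg hF hR) hB
  set M := F * R * B with hMdef
  have hMv : ∀ v, F *ᵥ (R *ᵥ (B *ᵥ v)) = M *ᵥ v := fun v => by simp [hMdef, Matrix.mul_assoc]
  have hMtv : ∀ v, Bᵀ *ᵥ (Rᵀ *ᵥ (Fᵀ *ᵥ v)) = Mᵀ *ᵥ v := fun v => by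
    simp [hMdef, Matrix.mul_assoc, transpose_mul]
  have hARv : ∀ v, A *ᵥ (R *ᵥ v) = -v := fun v => by rw [mulVec_mulVec, hAR]; simp [neg_mulVec]
  have hARtv : ∀ v, Aᵀ *ᵥ (Rᵀ *ᵥ v) = -v := fun v => by
    rw [mulVec_mulVec, ← transpose_mul, hRA]; simp [neg_mulVec]
  have hBt : ∀ i j, 0 ≤ Bᵀ i j := fun i j => hB j i
  have hFt : ∀ i j, 0 ≤ Fᵀ i j := fun i j => hF j i
  have hRt : ∀ i j, 0 ≤ Rᵀ i j := fun i j => hR j i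
  rcases exists_block_growth_or_exists_scaling blk hM ε with ⟨q, hq, hq0, hgrow⟩ | ⟨p, hp, hpM⟩
  · exfalso
    obtain ⟨Δ, hΔ0, hblk, hΔ, hΔw⟩ := exists_blockDiagonal_mulVec_eq blk hε.le hq
      (mulVec_nonneg_of_nonneg hM hq) hgrow
    -- Kernel vector `RBq`: `A` sends it to `-Bq`, and `BΔF` sends it to `BΔMq = Bq`.
    have h0 : (0 : ℝ) ∈ spectrum ℝ (A + B * Δ * F) := by
      refine mem_spectrum_iff_exists_mulVec.2 ⟨R *ᵥ (B *ᵥ q), fun hy => hq0 ?_, ?_⟩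
      · rw [← hΔw, ← hMv, hy, mulVec_zero, mulVec_zero]
      · rw [add_mulVec, hARv, ← mulVec_mulVec, hMv, ← mulVec_mulVec, hΔw]
        simp
    exact lt_irrefl _ (h Δ hΔ0 hblk hΔ 0 h0)
  have hs : 0 < √ε := Real.sqrt_pos.2 hε
  have hss : √ε * √ε = ε := Real.mul_self_sqrt hε.le
  obtain ⟨U, hU, hQU⟩ : ∃ U : ι → ℝ, (∀ i, 0 < U i) ∧
      ∀ i, ε * (Mᵀ *ᵥ fun l => ε * (p (blk l) * (M *ᵥ U) l)) i < p (blk i) * U i := by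
    -- `Q = ε²MᵀPM - P` is symmetric and `yᵀQy < 0` for nonnegative `y ≠ 0`, so Ville's first
    -- alternative fails and `QU < 0` for some positive `U`.
    set Q : Matrix ι ι ℝ :=
      ε ^ 2 • (Mᵀ * diagonal (p ∘ blk) * M) - diagonal (p ∘ blk) with hQ
    have hQv : ∀ (v : ι → ℝ) i, (Q *ᵥ v) i =
        ε * (Mᵀ *ᵥ fun l => ε * (p (blk l) * (M *ᵥ v) l)) i - p (blk i) * v i := by
      intro v i
      have h1 : (fun l => ε * (p (blk l) * (M *ᵥ v) l)) =
          ε • (diagonal (p ∘ blk) *ᵥ (M *ᵥ v)) := by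
        ext l; simp only [Pi.smul_apply, smul_eq_mul, mulVec_diagonal, Function.comp_apply]
      rw [h1, mulVec_smul, hQ, sub_mulVec, smul_mulVec, ← mulVec_mulVec, ← mulVec_mulVec]
      simp only [Pi.sub_apply, Pi.smul_apply, smul_eq_mul, mulVec_diagonal, Function.comp_apply]
      ring
    have hQt : Qᵀ = Q := by simp [hQ, transpose_mul, Matrix.mul_assoc]
    rcases exists_nonneg_transpose_or_exists_pos_neg Q with ⟨y, hy, hy0, hQy⟩ | ⟨U, hU, hQU⟩
    · exfalso
      rw [hQt] at hQy
      have h1 : 0 ≤ y ⬝ᵥ (Q *ᵥ y) := Finset.sum_nonneg fun i _ => mul_nonneg (hy i) (hQy i)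
      have h2 : y ⬝ᵥ (Q *ᵥ y) = ε ^ 2 * ∑ i, p (blk i) * (M *ᵥ y) i ^ 2 -
          ∑ i, p (blk i) * y i ^ 2 := by
        rw [hQ, sub_mulVec, smul_mulVec, dotProduct_sub, dotProduct_smul, ← mulVec_mulVec,
          ← mulVec_mulVec, dotProduct_mulVec y Mᵀ, vecMul_transpose]
        simp only [dotProduct, mulVec_diagonal, Function.comp_apply, smul_eq_mul]
        congr 1
        · congr 1
          exact Finset.sum_congr rfl fun i _ => by ring
        · exact Finset.sum_congr rfl fun i _ => by ring
      linarith [hpM y hy hy0]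
    · exact ⟨U, hU, fun i => by have := hQU i; rw [hQv] at this; linarith⟩
  obtain ⟨δ, hδ, hδ0⟩ := ((eventually_add_mul_lt (fun i => ε * (Mᵀ *ᵥ 1) i) hQU).and
    self_mem_nhdsWithin).exists
  replace hδ0 : 0 < δ := hδ0
  set V : ι → ℝ := (fun l => ε * (p (blk l) * (M *ᵥ U) l)) + δ • 1 with hV
  have hVgt : ∀ i, ε * (p (blk i) * (M *ᵥ U) i) < V i := fun i => by simpa [hV] using hδ0
  have hVpos : ∀ i, 0 < V i := fun i => lt_of_le_of_lt (mul_nonneg hε.le (mul_nonneg (hp _).le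
    (mulVec_nonneg_of_nonneg hM (fun i => (hU i).le) i))) (hVgt i)
  have hMV : ∀ i, ε * (Mᵀ *ᵥ V) i < p (blk i) * U i := fun i => by
    have := hδ i
    rw [hV, mulVec_add, mulVec_smul, Pi.add_apply, Pi.smul_apply, smul_eq_mul]
    linarith
  obtain ⟨η, ⟨hη1, hη2⟩, hη0⟩ := (((eventually_add_mul_lt
    (fun i => √ε * (p (blk i) * (F *ᵥ ξ₀) i)) hVgt).and (eventually_add_mul_lt
    (fun i => √ε * (Bᵀ *ᵥ ζ₀) i) hMV)).and self_mem_nhdsWithin).exists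
  replace hη0 : 0 < η := hη0
  -- With this `ξ`, `Aξ + √ε BU` collapses to `η Aξ₀ < 0`, and dually for `ζ`; `η` is small enough
  -- to preserve the other two inequalities.
  refine ⟨U, V, √ε • (R *ᵥ (B *ᵥ U)) + η • ξ₀, √ε • (Rᵀ *ᵥ (Fᵀ *ᵥ V)) + η • ζ₀, p, hp, hU, hVpos,
    fun i => ?_, fun i => ?_, fun i => ?_, fun i => ?_, fun i => ?_, fun i => ?_⟩
  · exact add_pos_of_nonneg_of_pos (mul_nonneg hs.le (mulVec_nonneg_of_nonneg hR
      (mulVec_nonneg_of_nonneg hB fun i => (hU i).le) i)) (mul_pos hη0 (hξ₀ i))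
  · exact add_pos_of_nonneg_of_pos (mul_nonneg hs.le (mulVec_nonneg_of_nonneg hRt
      (mulVec_nonneg_of_nonneg hFt fun i => (hVpos i).le) i)) (mul_pos hη0 (hζ₀ i))
  · rw [mulVec_add, mulVec_smul, mulVec_smul, hMv]
    simp only [Pi.add_apply, Pi.smul_apply, smul_eq_mul]
    linear_combination hη1 i + (p (blk i) * (M *ᵥ U) i) * hss
  · rw [mulVec_add, mulVec_smul, mulVec_smul, hARv]
    simp only [Pi.add_apply, Pi.smul_apply, Pi.neg_apply, smul_eq_mul]
    linarith [mul_neg_of_pos_of_neg hη0 (hAξ₀ i)]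
  · rw [mulVec_add, mulVec_smul, mulVec_smul, hMtv]
    simp only [Pi.add_apply, Pi.smul_apply, smul_eq_mul]
    linear_combination hη2 i + (Mᵀ *ᵥ V) i * hss
  · rw [mulVec_add, mulVec_smul, mulVec_smul, hARtv]
    simp only [Pi.add_apply, Pi.smul_apply, Pi.neg_apply, smul_eq_mul]
    linarith [mul_neg_of_pos_of_neg hη0 (hAζ₀ i)]

/-- Certificates are strict, so they tolerate a small shift of the spectrum. -/
theorem Certified.exists_shift {ι κ : Type*} [Fintype ι] [DecidableEq ι] {blk : ι → κ}
    {A B F : Matrix ι ι ℝ} {ε : ℝ} (h : Certified blk A B F ε) :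
    ∃ η : ℝ, 0 < η ∧ Certified blk (A + η • (1 : Matrix ι ι ℝ)) B F ε := by
  obtain ⟨U, V, ξ, ζ, p, hp, hU, hV, hξ, hζ, h1, h2, h3, h4⟩ := h
  obtain ⟨η, ⟨hη1, hη2⟩, hη0⟩ := (((eventually_add_mul_lt ξ h2).and
    (eventually_add_mul_lt ζ h4)).and self_mem_nhdsWithin).exists
  refine ⟨η, hη0, U, V, ξ, ζ, p, hp, hU, hV, hξ, hζ, h1, fun i => ?_, h3, fun i => ?_⟩
  · have := hη1 i
    simp only [add_mulVec, smul_mulVec, one_mulVec, Pi.add_apply, Pi.smul_apply, smul_eq_mul]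
    linarith
  · have := hη2 i
    simp only [transpose_add, transpose_smul, transpose_one, add_mulVec, smul_mulVec, one_mulVec,
      Pi.add_apply, Pi.smul_apply, smul_eq_mul]
    linarith

/-! ### Translation to the structured sets and the scaled inequalities -/

/-- The block to which an index belongs. -/
def blockOf {φ σ : ℕ} {m : Fin φ → ℕ} : BlockIndex m σ → Fin φ ⊕ Fin σ :=
  Sum.map Sigma.fst id

theorem mem_uncertaintySet_iff {φ σ : ℕ} {m : Fin φ → ℕ} {Δ : BlockMatrix m σ} :
    Δ ∈ uncertaintySet m σ ↔ (∀ i j, 0 ≤ Δ i j) ∧ ∀ i j, blockOf i ≠ blockOf j → Δ i j = 0 := by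
  constructor
  · rintro ⟨D, d, hD, hd, rfl⟩
    refine ⟨?_, ?_⟩
    · rintro (⟨k, i⟩ | i) (⟨l, j⟩ | j)
      · rcases eq_or_ne k l with rfl | hkl
        · simpa [blkdiag] using hD k i j
        · simp [blkdiag, blockDiagonal'_apply_ne _ _ _ hkl]
      · simp [blkdiag]
      · simp [blkdiag]
      · rcases eq_or_ne i j with rfl | hij
        · simpa [blkdiag] using hd i
        · simp [blkdiag, hij]
    · rintro (⟨k, i⟩ | i) (⟨l, j⟩ | j) hne
      · have hkl : k ≠ l := fun h => hne (by simp [blockOf, h])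
        simp [blkdiag, blockDiagonal'_apply_ne _ _ _ hkl]
      · simp [blkdiag]
      · simp [blkdiag]
      · have hij : i ≠ j := fun h => hne (by rw [h])
        simp [blkdiag, hij]
  · rintro ⟨h0, hne⟩
    refine ⟨fun k => of fun i j => Δ (Sum.inl ⟨k, i⟩) (Sum.inl ⟨k, j⟩),
      fun l => Δ (Sum.inr l) (Sum.inr l), fun k i j => h0 _ _, fun l => h0 _ _, ?_⟩
    ext (⟨k, i⟩ | i) (⟨l, j⟩ | j)
    · rcases eq_or_ne k l with rfl | hkl
      · simp [blkdiag]
      · rw [hne _ _ (by simpa [blockOf] using hkl)]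
        simp [blkdiag, blockDiagonal'_apply_ne _ _ _ hkl]
    · rw [hne _ _ (by simp [blockOf])]
      simp [blkdiag]
    · rw [hne _ _ (by simp [blockOf])]
      simp [blkdiag]
    · rcases eq_or_ne i j with rfl | hij
      · simp [blkdiag]
      · rw [hne _ _ (by simpa [blockOf] using hij)]
        simp [blkdiag, hij]

theorem mem_scalingSet_iff {φ σ : ℕ} {m : Fin φ → ℕ} {P : BlockMatrix m σ} :
    P ∈ scalingSet m σ ↔ ∃ p : Fin φ ⊕ Fin σ → ℝ, (∀ k, 0 < p k) ∧ P = diagonal (p ∘ blockOf) := by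
  have key : ∀ (a : Fin φ → ℝ) (b : Fin σ → ℝ),
      (blkdiag (fun k => a k • (1 : Matrix (Fin (m k)) (Fin (m k)) ℝ)) b : BlockMatrix m σ) =
        diagonal (Sum.elim a b ∘ blockOf) := by
    intro a b
    ext (⟨k, i⟩ | i) (⟨l, j⟩ | j)
    · rcases eq_or_ne k l with rfl | hkl
      · simp [blkdiag, blockOf, diagonal_apply, one_apply]
      · simp [blkdiag, blockDiagonal'_apply_ne _ _ _ hkl, hkl]
    · simp [blkdiag]
    · simp [blkdiag]
    · simp [blkdiag, blockOf, diagonal_apply]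
  constructor
  · rintro ⟨a, b, ha, hb, rfl⟩
    exact ⟨Sum.elim a b, by rintro (k | k) <;> simp [ha, hb], key a b⟩
  · rintro ⟨p, hp, rfl⟩
    refine ⟨p ∘ Sum.inl, p ∘ Sum.inr, fun k => hp _, fun k => hp _, ?_⟩
    rw [key, Sum.elim_comp_inl_inr]

/-- The change of variables is `U = Π^(-1/2) u`, `V = Π^(1/2) ν`. -/
theorem scaledFeasible_iff_certified {φ σ : ℕ} {m : Fin φ → ℕ} (k γ h : BlockIndex m σ → ℝ)
    (G E F : BlockMatrix m σ) (ε ς : ℝ) :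
    ScaledFeasible k γ h G E F ε ς ↔
      Certified blockOf
        (diagonal k * ((-1 : BlockMatrix m σ) + diagonal γ * (diagonal h)⁻¹ * G)
          + ς • (1 : BlockMatrix m σ))
        (diagonal k * diagonal γ * (diagonal h)⁻¹ * E) F ε := by
  set A : BlockMatrix m σ := diagonal k * ((-1 : BlockMatrix m σ) + diagonal γ * (diagonal h)⁻¹ * G)
    + ς • (1 : BlockMatrix m σ) with hA
  set B : BlockMatrix m σ := diagonal k * diagonal γ * (diagonal h)⁻¹ * E with hB
  have hAt : ((-1 : BlockMatrix m σ) + Gᵀ * (diagonal h)⁻¹ * diagonal γ) * diagonal k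
      + ς • (1 : BlockMatrix m σ) = Aᵀ := by
    simp [hA, transpose_mul, transpose_nonsing_inv, Matrix.mul_assoc]
  have hBt : ∀ D : BlockMatrix m σ,
      D * Eᵀ * (diagonal h)⁻¹ * diagonal γ * diagonal k = D * Bᵀ := by
    intro D
    simp [hB, transpose_mul, transpose_nonsing_inv, Matrix.mul_assoc, mul_comm (γ _) (k _)]
  have hpow : ∀ (p : Fin φ ⊕ Fin σ → ℝ) (s : ℝ),
      diagPow (diagonal (p ∘ blockOf) : BlockMatrix m σ) s =
        diagonal fun i => p (blockOf i) ^ s := by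
    intro p s
    simp [diagPow]
  have hneg : ∀ (p : Fin φ ⊕ Fin σ → ℝ), (∀ k, 0 < p k) → ∀ k,
      p k ^ (-(1 / 2 : ℝ)) = (√(p k))⁻¹ := fun p hp k => by
    rw [Real.rpow_neg (hp k).le, Real.sqrt_eq_rpow]
  have hdiag : ∀ d v : BlockIndex m σ → ℝ, diagonal d *ᵥ v = fun i => d i * v i := fun d v => by
    ext i; rw [mulVec_diagonal]
  unfold ScaledFeasible Certified
  simp only [hAt, hBt, ← hA, ← hB]
  clear_value A B
  constructor
  · rintro ⟨u, ν, ξ, ζ, P, hP, hu, hν, hξ, hζ, h1, h2, h3, h4⟩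
    obtain ⟨p, hp, rfl⟩ := mem_scalingSet_iff.1 hP
    have hd : ∀ i : BlockIndex m σ, 0 < √(p (blockOf i)) := fun i => Real.sqrt_pos.2 (hp _)
    have hdd : ∀ i : BlockIndex m σ, √(p (blockOf i)) * √(p (blockOf i)) = p (blockOf i) :=
      fun i => Real.mul_self_sqrt (hp _).le
    simp only [hpow, hneg p hp, ← Real.sqrt_eq_rpow, ← mulVec_mulVec, hdiag, Pi.add_apply,
      Pi.smul_apply, smul_eq_mul] at h1 h2 h3 h4
    refine ⟨fun i => (√(p (blockOf i)))⁻¹ * u i, fun i => √(p (blockOf i)) * ν i, ξ, ζ, p, hp,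
      fun i => mul_pos (inv_pos.2 (hd i)) (hu i), fun i => mul_pos (hd i) (hν i), hξ, hζ,
      fun i => ?_, h2, fun i => ?_, h4⟩
    · have := mul_lt_mul_of_pos_left (h1 i) (hd i)
      rw [← hdd i]
      linarith
    · have := mul_lt_mul_of_pos_left (h3 i) (hd i)
      have hd' := (hd i).ne'
      calc √ε * (Bᵀ *ᵥ ζ) i
          = √(p (blockOf i)) * (√ε * ((√(p (blockOf i)))⁻¹ * (Bᵀ *ᵥ ζ) i)) := by field_simp
        _ < √(p (blockOf i)) * u i := this
        _ = p (blockOf i) * ((√(p (blockOf i)))⁻¹ * u i) := by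
            nth_rw 2 [← hdd i]
            field_simp
  · rintro ⟨U, V, ξ, ζ, p, hp, hU, hV, hξ, hζ, h1, h2, h3, h4⟩
    have hd : ∀ i : BlockIndex m σ, 0 < √(p (blockOf i)) := fun i => Real.sqrt_pos.2 (hp _)
    have hdd : ∀ i : BlockIndex m σ, √(p (blockOf i)) * √(p (blockOf i)) = p (blockOf i) :=
      fun i => Real.mul_self_sqrt (hp _).le
    have hcancel : ∀ v : BlockIndex m σ → ℝ,
        (fun i => (√(p (blockOf i)))⁻¹ * (√(p (blockOf i)) * v i)) = v := fun v => by
      ext i; rw [inv_mul_cancel_left₀ (hd i).ne']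
    have hcancel' : ∀ v : BlockIndex m σ → ℝ,
        (fun i => √(p (blockOf i)) * ((√(p (blockOf i)))⁻¹ * v i)) = v := fun v => by
      ext i; rw [mul_inv_cancel_left₀ (hd i).ne']
    refine ⟨fun i => √(p (blockOf i)) * U i, fun i => (√(p (blockOf i)))⁻¹ * V i, ξ, ζ,
      diagonal (p ∘ blockOf), mem_scalingSet_iff.2 ⟨p, hp, rfl⟩,
      fun i => mul_pos (hd i) (hU i), fun i => mul_pos (inv_pos.2 (hd i)) (hV i), hξ, hζ, ?_⟩
    simp only [hpow, hneg p hp, ← Real.sqrt_eq_rpow, ← mulVec_mulVec, hdiag, Pi.add_apply,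
      Pi.smul_apply, smul_eq_mul, hcancel, hcancel']
    refine ⟨fun i => ?_, h2, fun i => ?_, h4⟩
    · rw [lt_inv_mul_iff₀ (hd i)]
      have := h1 i
      rw [← hdd i] at this
      linarith
    · rw [mul_left_comm, inv_mul_lt_iff₀ (hd i), ← mul_assoc, hdd]
      exact h3 i

/-! ### The worst-case rate -/

theorem inv_diagonal_of_pos {ι : Type*} [Fintype ι] [DecidableEq ι] {h : ι → ℝ}
    (hh : ∀ i, 0 < h i) : (diagonal h)⁻¹ = diagonal fun i => (h i)⁻¹ := by
  refine inv_eq_right_inv ?_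
  rw [diagonal_mul_diagonal, ← diagonal_one]
  congr 1
  ext i
  exact mul_inv_cancel₀ (hh i).ne'

/-- Nonemptiness matters: the real `sSup` of the empty set is `0`. -/
theorem lambdaMax_lt_iff {ι : Type*} [Fintype ι] [DecidableEq ι] {A : Matrix ι ι ℝ}
    (hA : (spectrum ℝ A).Nonempty) {c : ℝ} : lambdaMax A < c ↔ ∀ t ∈ spectrum ℝ A, t < c :=
  (A.finite_real_spectrum).csSup_lt_iff hA

theorem mem_spectrum_add_smul_one {ι : Type*} [Fintype ι] [DecidableEq ι] {A : Matrix ι ι ℝ}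
    {s t : ℝ} : t ∈ spectrum ℝ (A + s • (1 : Matrix ι ι ℝ)) ↔ t - s ∈ spectrum ℝ A := by
  simp only [mem_spectrum_iff_exists_mulVec]
  refine exists_congr fun x => and_congr_right fun _ => ?_
  rw [add_mulVec, smul_mulVec, one_mulVec, sub_smul, eq_sub_iff_add_eq]

theorem worstCaseRate_lt_iff_scaledFeasible {φ σ : ℕ} {m : Fin φ → ℕ} [Nonempty (BlockIndex m σ)]
    {k γ h : BlockIndex m σ → ℝ} {g : BlockIndex m σ → BlockIndex m σ → ℝ}
    {E F : BlockMatrix m σ} {ε : ℝ}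
    (hk : ∀ i, 0 < k i) (hγ : ∀ i, 0 ≤ γ i) (hh : ∀ i, 0 < h i)
    (hg : ∀ i j, i ≠ j → 0 ≤ g j i)
    (hE : ∀ i j, 0 ≤ E i j) (hF : ∀ i j, 0 ≤ F i j) (hε : 0 < ε) (ς : ℝ) :
    worstCaseRate k γ h (interferenceMatrix g) E F ε < ((-ς : ℝ) : EReal) ↔
      ScaledFeasible k γ h (interferenceMatrix g) E F ε ς := by
  rw [scaledFeasible_iff_certified]
  set A : BlockMatrix m σ :=
    diagonal k * ((-1 : BlockMatrix m σ) + diagonal γ * (diagonal h)⁻¹ * interferenceMatrix g) with hA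
  set B : BlockMatrix m σ := diagonal k * diagonal γ * (diagonal h)⁻¹ * E with hB
  have hcl : ∀ Δ, closedLoop k γ h (interferenceMatrix g) E F Δ = A + B * Δ * F := fun Δ => rfl
  have hAM : IsMetzler A := by
    intro i j hij
    rw [hA, inv_diagonal_of_pos hh, diagonal_mul_diagonal, diagonal_mul, Matrix.add_apply, diagonal_mul,
      Matrix.neg_apply, one_apply_ne hij, neg_zero, zero_add]
    have : 0 ≤ interferenceMatrix g i j := by simp [interferenceMatrix, hij.symm, hg j i hij.symm]
    exact mul_nonneg (hk i).le (mul_nonneg (mul_nonneg (hγ i) (inv_nonneg.2 (hh i).le)) this)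
  have hB0 : ∀ i j, 0 ≤ B i j := by
    intro i j
    rw [hB, inv_diagonal_of_pos hh, diagonal_mul_diagonal, diagonal_mul_diagonal, diagonal_mul]
    exact mul_nonneg (mul_nonneg (mul_nonneg (hk i).le (hγ i)) (inv_nonneg.2 (hh i).le)) (hE i j)
  have hcomm : ∀ (Δ : BlockMatrix m σ) (s : ℝ), A + s • (1 : BlockMatrix m σ) + B * Δ * F =
      A + B * Δ * F + s • (1 : BlockMatrix m σ) := fun Δ s => add_right_comm _ _ _
  have hne : ∀ Δ : BlockMatrix m σ, (∀ i j, 0 ≤ Δ i j) → (spectrum ℝ (A + B * Δ * F)).Nonempty :=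
    fun Δ hΔ => IsMetzler.spectrum_nonempty fun i j hij =>
      add_nonneg (hAM i j hij) (matrix_mul_nonneg (matrix_mul_nonneg hB0 hΔ) hF i j)
  constructor
  · intro hlt
    refine certified_of_spectrum_neg (hAM.add_smul_one ς) hB0 hF hε fun Δ hΔ0 hblk hΔ t ht => ?_
    rw [hcomm, mem_spectrum_add_smul_one] at ht
    have hle : ((lambdaMax (closedLoop k γ h (interferenceMatrix g) E F Δ) : ℝ) : EReal) ≤
        worstCaseRate k γ h (interferenceMatrix g) E F ε :=
      le_iSup₂_of_le Δ ⟨mem_uncertaintySet_iff.2 ⟨hΔ0, hblk⟩, hΔ⟩ le_rfl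
    have hlam := EReal.coe_lt_coe_iff.1 (hle.trans_lt hlt)
    have := (lambdaMax_lt_iff (hne Δ hΔ0)).1 hlam _ ht
    linarith
  · intro hcert
    -- The shift bounds every `lambdaMax` by `-ς - η` uniformly in `Δ`, so strictness survives the
    -- supremum without a compactness argument.
    obtain ⟨η, hη, hshift⟩ := hcert.exists_shift
    have hle : worstCaseRate k γ h (interferenceMatrix g) E F ε ≤ ((-ς - η : ℝ) : EReal) := by
      refine iSup₂_le fun Δ hΔ => ?_
      obtain ⟨hΔ0, hblk⟩ := mem_uncertaintySet_iff.1 hΔ.1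
      rw [EReal.coe_le_coe_iff, hcl]
      refine ((lambdaMax_lt_iff (hne Δ hΔ0)).2 fun t ht => ?_).le
      have := hshift.spectrum_neg ((hAM.add_smul_one ς).add_smul_one η) hB0 hF hε hΔ0 hΔ.2 hblk
        (t := t + ς + η) (by
          rw [add_right_comm, hcomm, mem_spectrum_add_smul_one, mem_spectrum_add_smul_one]
          simpa using ht)
      linarith
    exact hle.trans_lt (EReal.coe_lt_coe_iff.2 (by linarith))

theorem mainTheorem8 {φ σ : ℕ} (m : Fin φ → ℕ) [Nonempty (BlockIndex m σ)]
    (k γ h : BlockIndex m σ → ℝ) (g : BlockIndex m σ → BlockIndex m σ → ℝ)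
    (E F : BlockMatrix m σ) (ε ς : ℝ)
    (hk : ∀ i, 0 < k i) (hγ : ∀ i, 0 ≤ γ i) (hh : ∀ i, 0 < h i)
    (hg : ∀ i j, i ≠ j → 0 ≤ g j i)
    (hE : ∀ i j, 0 ≤ E i j) (hF : ∀ i j, 0 ≤ F i j)
    (hε : 0 < ε) (hς : ς ∈ Set.Ioo (0 : ℝ) 1) :
    (worstCaseRate k γ h (interferenceMatrix g) E F ε < ((-ς : ℝ) : EReal) ↔
      ScaledFeasible k γ h (interferenceMatrix g) E F ε ς) ∧
    (worstCaseRate k γ h (interferenceMatrix g) E F ε ≤ ((-ς : ℝ) : EReal) ↔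
      ∀ ς' ∈ Set.Ioo (0 : ℝ) ς, ScaledFeasible k γ h (interferenceMatrix g) E F ε ς') := by
  refine ⟨worstCaseRate_lt_iff_scaledFeasible hk hγ hh hg hE hF hε ς, fun hle ς' hς' => ?_,
    fun hall => ?_⟩
  · rw [← worstCaseRate_lt_iff_scaledFeasible hk hγ hh hg hE hF hε]
    exact hle.trans_lt (EReal.coe_lt_coe_iff.2 (neg_lt_neg hς'.2))
  · by_contra! hlt
    have hlt' := fun ς' hς' =>
      (worstCaseRate_lt_iff_scaledFeasible hk hγ hh hg hE hF hε ς').2 (hall ς' hς')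
    obtain ⟨c, hc1, hc2⟩ := EReal.lt_iff_exists_real_btwn.1 hlt
    -- Feasibility at `ς / 2` ensures `c < 0`, so that `-c` is an admissible level in `(0, ς)`.
    have hhalf := hlt' (ς / 2) ⟨half_pos hς.1, half_lt_self hς.1⟩
    have h1 := EReal.coe_lt_coe_iff.1 hc1
    have h2 := EReal.coe_lt_coe_iff.1 (hc2.trans hhalf)
    have h3 := hlt' (-c) ⟨by linarith [hς.1], by linarith⟩
    rw [neg_neg] at h3
    exact lt_asymm hc2 h3
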